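/- For integers $n\ge 1$ and $k\ge 0$ let $$N_q(n,k)=\frac{1}{[n]}\left[{n\atop k}\right]\left[{n\atop k+1}\right]q^{k^2+k}$$ be the $q$-Narayana number, where $[k]=(1-q^k)/(1-q)$, $[k]!=[1][2]\cdots[k]$, and $\left[{n\atop j}\right]=\frac{[n]!}{[j]!\,[n-j]!}$ for $0\le j\le n$, $\left[{n\atop j}\right]=0$ for $j>n$. For a partition $\lambda$ let $s_\lambda=\sum_T x^T$ be the Schur function, the sum being over all semistandard Young tableaux $T$ of shape $\lambda$, and let $(2^k)$ be the partition with $k$ parts equal to $2$. A symmetric function is called Schur positive if it is a linear combination of Schur functions with nonnegative coefficients. (1) For every positive integer $n$ and every $k\ge 0$, $N_q(n,k)$ is a polynomial in $q$, and $N_q(n,k)=s_{(2^k)}(q,q^2,\dots,q^{n-1})$. Moreover, for each fixed $n\ge 1$ the sequence $(N_q(n,k))_{k\ge 0}$ is strongly $q$-log-concave: for all $k\ge l\ge 1$ the polynomial $$N_q(n,k)\,N_q(n,l)-N_q(n,k+1)\,N_q(n,l-1)$$ has nonnegative coefficients. (2) For all integers $k\ge l\ge 1$ the symmetric function $$s_{(2^k)}s_{(2^l)}-s_{(2^{k+1})}s_{(2^{l-1})}$$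 (in infinitely many variables) is Schur positive. -/

import Mathlib

noncomputable section

/-- A semistandard Young tableau of shape `μ` is determined by its cells, so only finitely many
have all entries below `m`. -/
theorem finite_tableaux_lt (μ : YoungDiagram) (m : ℕ) :
    Finite {T : SemistandardYoungTableau μ // ∀ c ∈ μ.cells, T c.1 c.2 < m} := by
  refine Finite.of_injective
    (fun T => fun c : μ.cells => (⟨T.1 c.1.1 c.1.2, T.2 c.1 c.2⟩ : Fin m)) ?_
  intro T T' h
  apply Subtype.ext
  apply SemistandardYoungTableau.ext
  intro i j
  by_cases hc : (i, j) ∈ μ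
  · have := congrFun h ⟨(i, j), YoungDiagram.mem_cells _ |>.2 hc⟩
    simpa using this
  · rw [T.1.zeros hc, T'.1.zeros hc]

/-- The type of a tableau: `tableauType T i` is the number of cells with entry `i`.
Entries are numbered from `0`, so the entry `i` stands for the `(i+1)`-st letter. -/
def tableauType {μ : YoungDiagram} (T : SemistandardYoungTableau μ) : ℕ →₀ ℕ :=
  ∑ c ∈ μ.cells, Finsupp.single (T c.1 c.2) 1

/-- There are only finitely many semistandard tableaux of given shape and type, so the
cardinality in `schurFunction` is a genuine count. -/
theorem finite_tableaux_of_type (μ : YoungDiagram) (α : ℕ →₀ ℕ) :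
    Finite {T : SemistandardYoungTableau μ // tableauType T = α} := by
  have key : ∀ T : {T : SemistandardYoungTableau μ // tableauType T = α},
      ∀ c ∈ μ.cells, T.1 c.1 c.2 < α.support.sup id + 1 := by
    rintro ⟨T, rfl⟩ c hc
    have hmem : T c.1 c.2 ∈ (tableauType T).support := by
      rw [Finsupp.mem_support_iff, tableauType, Finsupp.finsetSum_apply]
      intro h0
      have h1 := (Finset.sum_eq_zero_iff.1 h0) c hc
      simp at h1
    have := Finset.le_sup (f := id) hmem
    simp only [id] at this
    exact Nat.lt_succ_of_le this
  have := finite_tableaux_lt μ (α.support.sup id + 1)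
  refine Finite.of_injective
    (fun T => (⟨T.1, key T⟩ :
      {T : SemistandardYoungTableau μ // ∀ c ∈ μ.cells, T c.1 c.2 < α.support.sup id + 1})) ?_
  intro T T' h
  exact Subtype.ext (congrArg (fun S => S.1) h)

/-- The Schur function `s_μ = ∑_T x^T` in the variables `x₀, x₁, x₂, …`, as a formal power
series: the coefficient of `x^α` is the number of semistandard tableaux of shape `μ` and
type `α`. -/
def schurFunction (μ : YoungDiagram) : MvPowerSeries ℕ ℤ :=
  fun α => (Nat.card {T : SemistandardYoungTableau μ // tableauType T = α} : ℤ)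

instance schurFintype (μ : YoungDiagram) (m : ℕ) :
    Fintype {T : SemistandardYoungTableau μ // ∀ c ∈ μ.cells, T c.1 c.2 < m} :=
  haveI := finite_tableaux_lt μ m
  Fintype.ofFinite _

/-- The Schur function of shape `μ` evaluated on a finite list of `m` variables,
`s_μ(x₀, …, x_{m-1}) = ∑_T ∏_c x_{T(c)}`, the sum being over the semistandard tableaux of
shape `μ` with entries in `{0, …, m-1}`. -/
def schurEval {R : Type*} [CommRing R] (μ : YoungDiagram) {m : ℕ} (x : Fin m → R) : R :=
  ∑ T : {T : SemistandardYoungTableau μ // ∀ c ∈ μ.cells, T c.1 c.2 < m},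
    ∏ c : μ.cells, x ⟨T.1 c.1.1 c.1.2, T.2 c.1 c.2⟩

/-- A (bounded degree) symmetric function is Schur positive (`s`-positive) if it is a finite
linear combination of Schur functions with nonnegative coefficients. -/
def SchurPositive (f : MvPowerSeries ℕ ℤ) : Prop :=
  ∃ a : YoungDiagram →₀ ℤ, (∀ μ, 0 ≤ a μ) ∧ f = a.sum fun μ c => c • schurFunction μ

/-- The partition `(2^k)`: the Young diagram with `k` rows of length `2`. -/
def twoColumn (k : ℕ) : YoungDiagram where
  cells := Finset.range k ×ˢ Finset.range 2
  isLowerSet := by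
    rintro ⟨a, b⟩ ⟨c, d⟩ ⟨h1, h2⟩ h
    simp only [Finset.coe_product, Finset.coe_range, Set.mem_prod, Set.mem_Iio] at h ⊢
    exact ⟨lt_of_le_of_lt h1 h.1, lt_of_le_of_lt h2 h.2⟩

/-- A sequence of real polynomials is strongly `q`-log-concave if
`f_m f_n - f_{m+1} f_{n-1}` has nonnegative coefficients for all `m ≥ n ≥ 1`. -/
def StronglyQLogConcave (f : ℕ → Polynomial ℝ) : Prop :=
  ∀ m n : ℕ, 1 ≤ n → n ≤ m → ∀ i : ℕ, 0 ≤ (f m * f n - f (m + 1) * f (n - 1)).coeff i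

/-- `[k] = (1 - q^k) / (1 - q)`, in the field of rational functions in `q`. -/
def qInt (k : ℕ) : RatFunc ℝ := (1 - RatFunc.X ^ k) / (1 - RatFunc.X)

/-- `[k]! = [1][2]⋯[k]`. -/
def qFactorial (k : ℕ) : RatFunc ℝ := ∏ i ∈ Finset.range k, qInt (i + 1)

/-- The `q`-binomial coefficient, `[n]! / ([j]! [n-j]!)` for `j ≤ n` and `0` for `j > n`. -/
def qBinomial (n j : ℕ) : RatFunc ℝ :=
  if j ≤ n then qFactorial n / (qFactorial j * qFactorial (n - j)) else 0

/-- The `q`-Narayana number `N_q(n,k)`, for `n ≥ 1`. -/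
def qNarayana (n k : ℕ) : RatFunc ℝ :=
  1 / qInt n * qBinomial n k * qBinomial n (k + 1) * RatFunc.X ^ (k ^ 2 + k)

end

/-!
Both parts rest on the Schur expansion, for `1 ≤ l ≤ k`,
`s_{(2^k)} s_{(2^l)} - s_{(2^{k+1})} s_{(2^{l-1})} = ∑_{a=0}^{l} s_{λ(a)}`,
where `λ(a)` is the partition whose conjugate is `(k+l-a, k, l, a)`.

It is obtained from the dual Jacobi–Trudi identity `s_λ = det (e_{c_i - i + j})`, where the `c_i` are
the column lengths of `λ` (`schurEval_colDiagram`). In finitely many variables both sides satisfy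
the same recursion in the number of variables. A tableau with entries at most `m` is a tableau
with entries below `m` on a smaller diagram, extended by a horizontal strip of entries `m`, which
removes at most one cell from each column (`sum_topColumns_eq`). On the other side,
`e_j(x₀, …, x_m) = e_j + x_m e_{j-1}` in each row and multilinearity of the determinant give the sum
over all sets of columns (`jacobiTrudiDet_succ`); those sets which do not leave a partition
contribute determinants with two equal rows or a zero row (`jacobiTrudiDet_eq_zero_or`).

The expansion then becomes an identity between determinants of orders `2` and `4`. In the Laplace
expansion of the determinant of `(k+l-a, k, l, a)` only the minors of the first and last rows
depend on `a`, and their sum over `a` telescopes to a few products of elementary symmetric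
functions (`sum_range_det_eq`); what is left is a polynomial identity (`sum_jacobiTrudiDet`).

A coefficient of a Schur function is seen in finitely many variables (`coeff_schurEval_X`), which
gives the expansion for power series, hence Schur positivity. Substituting `q, q², …, q^{n-1}`
gives polynomials with nonnegative coefficients on the right, hence strong `q`-log-concavity of
`s_{(2^k)}(q, …, q^{n-1})`. This polynomial is the `q`-Narayana number because it equals
`e_k² - e_{k+1} e_{k-1}`, `e_j(q, …, q^M) = q^{j(j+1)/2} [M choose j]` (`elemSymm_ratFuncX_pow`) and
`[a+1][b+1] - q[a][b] = [a+b+1]` (`qNarayana_succ_eq`).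
-/

/-! ### Elementary symmetric functions and dual Jacobi–Trudi determinants -/

/-- The elementary symmetric function `e_j(x₀, …, x_{m-1})`, with an integer index `j` (it vanishes
for `j < 0`), defined by the recursion on the number of variables. -/
def elemSymm {R : Type*} [CommRing R] (x : ℕ → R) : ℕ → ℤ → R
  | 0, j => if j = 0 then 1 else 0
  | m + 1, j => elemSymm x m j + x m * elemSymm x m (j - 1)

theorem elemSymm_of_neg {R : Type*} [CommRing R] (x : ℕ → R) (m : ℕ) {j : ℤ} (hj : j < 0) :
    elemSymm x m j = 0 := by
  induction m generalizing j with
  | zero => simp [elemSymm, hj.ne]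
  | succ m ih => simp [elemSymm, ih hj, ih (j := j - 1) (by omega)]

theorem elemSymm_zero {R : Type*} [CommRing R] (x : ℕ → R) (m : ℕ) : elemSymm x m 0 = 1 := by
  induction m with
  | zero => simp [elemSymm]
  | succ m ih => simp [elemSymm, ih, elemSymm_of_neg]

/-- The dual Jacobi–Trudi determinant `det (e_{c_i - i + j})` in the variables
`x₀, …, x_{m-1}`. The `c_i` are the column lengths of the diagram; integers are allowed in order
to state the recursion in `m`. -/
def jacobiTrudiDet {R : Type*} [CommRing R] {n : ℕ} (x : ℕ → R) (m : ℕ) (c : Fin n → ℤ) : R :=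
  Matrix.det (Matrix.of fun i j : Fin n => elemSymm x m (c i - i + j))

/-- The recursion in the number of variables, from expanding every row of the
determinant along `e_j(x₀, …, x_m) = e_j + x_m e_{j-1}`. -/
theorem jacobiTrudiDet_succ {R : Type*} [CommRing R] {n : ℕ} (x : ℕ → R) (m : ℕ)
    (c : Fin n → ℤ) :
    jacobiTrudiDet x (m + 1) c =
      ∑ S : Finset (Fin n), x m ^ S.card *
        jacobiTrudiDet x m (fun i => c i - if i ∈ S then 1 else 0) := by
  have h := (Matrix.detRowAlternating (n := Fin n) (R := R)).toMultilinearMap.map_add_univ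
    (fun i j => x m * elemSymm x m (c i - 1 - i + j)) (fun i j => elemSymm x m (c i - i + j))
  have h0 : jacobiTrudiDet x (m + 1) c =
      (Matrix.detRowAlternating (n := Fin n) (R := R)).toMultilinearMap
      ((fun i (j : Fin n) => x m * elemSymm x m (c i - 1 - i + j)) +
        (fun i (j : Fin n) => elemSymm x m (c i - i + j))) := by
    refine congrArg Matrix.det ?_
    ext i j
    simp only [Matrix.of_apply, elemSymm, Pi.add_apply]
    rw [add_comm, show c i - i + j - 1 = c i - 1 - i + j by ring]
  rw [h0, h]
  refine Finset.sum_congr rfl fun S _ => ?_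
  have h1 := (Matrix.detRowAlternating (n := Fin n) (R := R)).toMultilinearMap.map_smul_univ
    (fun i => if i ∈ S then x m else 1)
    (fun i j => elemSymm x m ((c i - if i ∈ S then 1 else 0) - i + j))
  have h2 : ∏ i, (if i ∈ S then x m else 1) = x m ^ S.card := by simp [Finset.prod_ite_mem]
  rw [h2, smul_eq_mul] at h1
  refine Eq.trans ?_ h1
  congr 1
  ext i j
  by_cases hi : i ∈ S <;> simp [hi]

theorem jacobiTrudiDet_zero {R : Type*} [CommRing R] {n : ℕ} (x : ℕ → R) (c : Fin n → ℕ)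
    (hc : Antitone c) :
    jacobiTrudiDet x 0 (fun i => (c i : ℤ)) = if c = 0 then 1 else 0 := by
  split_ifs with h
  · have : (Matrix.of fun i j : Fin n => elemSymm x 0 ((c i : ℤ) - i + j)) = 1 := by
      ext i j
      simp only [h, elemSymm, Matrix.of_apply, Matrix.one_apply, Fin.ext_iff]
      refine if_congr ?_ rfl rfl
      simp only [Pi.zero_apply]
      omega
    rw [jacobiTrudiDet, this, Matrix.det_one]
  · obtain ⟨i, hi⟩ := Function.ne_iff.1 h
    have hn : 0 < n := i.pos
    have h0 : c i ≤ c ⟨0, hn⟩ := hc (Fin.mk_le_of_le_val (Nat.zero_le _))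
    refine Matrix.det_eq_zero_of_row_eq_zero ⟨0, hn⟩ fun j => ?_
    simp only [Pi.zero_apply] at hi
    simp only [Matrix.of_apply, elemSymm]
    rw [if_neg]
    omega

/-- Removing from a partition at most one cell in each column either gives a partition, or gives a
sequence with a vanishing determinant: two equal consecutive rows, or a zero last row. -/
theorem jacobiTrudiDet_eq_zero_or {R : Type*} [CommRing R] {n : ℕ} (x : ℕ → R) (m : ℕ)
    (c : Fin n → ℕ) (hc : Antitone c) (S : Finset (Fin n)) :
    (Antitone (fun i => c i - if i ∈ S then 1 else 0) ∧ ∀ i ∈ S, 0 < c i) ∨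
      jacobiTrudiDet x m (fun i => (c i : ℤ) - if i ∈ S then 1 else 0) = 0 := by
  cases n with
  | zero => exact Or.inl ⟨fun i => i.elim0, fun i => i.elim0⟩
  | succ n =>
    by_cases h : ∀ i : Fin n, ((c i.succ : ℤ) - if i.succ ∈ S then 1 else 0) ≤
        (c i.castSucc : ℤ) - if i.castSucc ∈ S then 1 else 0
    · have hanti : Antitone (fun i => (c i : ℤ) - if i ∈ S then 1 else 0) :=
        Fin.antitone_iff_succ_le.2 h
      by_cases hl : 0 ≤ (c (Fin.last n) : ℤ) - if Fin.last n ∈ S then 1 else 0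
      · left
        have key : ∀ i, 0 ≤ (c i : ℤ) - if i ∈ S then 1 else 0 := fun i =>
          hl.trans (hanti (Fin.le_last i))
        refine ⟨fun i j hij => ?_, fun i hi => ?_⟩
        · have h1 := hanti hij
          have h2 := key i
          have h3 := key j
          simp only at h1 ⊢
          split_ifs at * <;> omega
        · have := key i
          rw [if_pos hi] at this
          omega
      · right
        refine Matrix.det_eq_zero_of_row_eq_zero (Fin.last n) fun j => ?_
        have := j.is_le
        rw [Matrix.of_apply, elemSymm_of_neg]
        simp only [Fin.val_last] at hl ⊢
        omega
    · right
      push Not at h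
      obtain ⟨i, hi⟩ := h
      have h1 : c i.succ ≤ c i.castSucc := hc (Fin.castSucc_lt_succ).le
      refine Matrix.det_zero_of_row_eq (Fin.castSucc_lt_succ (i := i)).ne ?_
      ext j
      simp only [Matrix.of_apply]
      congr 1
      simp only [Fin.val_succ, Fin.val_castSucc]
      split_ifs at * <;> push_cast <;> omega

/-! ### The product of two pairs of equal columns -/

/-- Laplace expansion of a `4 × 4` determinant along the pairs of rows `{0, 3}` and `{1, 2}`. -/
theorem det_fin_four {R : Type*} [CommRing R] (A : Matrix (Fin 4) (Fin 4) R) :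
    A.det =
      (A 0 0 * A 3 1 - A 0 1 * A 3 0) * (A 1 2 * A 2 3 - A 1 3 * A 2 2) -
      (A 0 0 * A 3 2 - A 0 2 * A 3 0) * (A 1 1 * A 2 3 - A 1 3 * A 2 1) +
      (A 0 0 * A 3 3 - A 0 3 * A 3 0) * (A 1 1 * A 2 2 - A 1 2 * A 2 1) +
      (A 0 1 * A 3 2 - A 0 2 * A 3 1) * (A 1 0 * A 2 3 - A 1 3 * A 2 0) -
      (A 0 1 * A 3 3 - A 0 3 * A 3 1) * (A 1 0 * A 2 2 - A 1 2 * A 2 0) +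
      (A 0 2 * A 3 3 - A 0 3 * A 3 2) * (A 1 0 * A 2 1 - A 1 1 * A 2 0) := by
  have h : ∀ (i : Fin 4) (j : Fin 3), i.succAbove j = if j.1 < i.1 then j.castSucc else j.succ := by
    decide
  rw [Matrix.det_succ_row_zero]
  simp [Fin.sum_univ_succ, Matrix.det_fin_three, h]
  ring

/-- The sum over `a` of the minors of the rows starting with `e_{k+l-a}` and `e_{a-3}` telescopes,
so that the Laplace expansion gives the partial sums in closed form. -/
theorem sum_range_det_eq {R : Type*} [CommRing R] (e : ℤ → R) (he : ∀ j, j < 0 → e j = 0)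
    (k l : ℤ) (N : ℕ) :
    ∑ a ∈ Finset.range N,
      Matrix.det !![e (k + l - a), e (k + l - a + 1), e (k + l - a + 2), e (k + l - a + 3);
        e (k - 1), e k, e (k + 1), e (k + 2);
        e (l - 2), e (l - 1), e l, e (l + 1);
        e ((a : ℤ) - 3), e ((a : ℤ) - 2), e ((a : ℤ) - 1), e (a : ℤ)] =
    (e (k + l + 1 - N) * e ((N : ℤ) - 3)) * (e (k + 1) * e (l + 1) - e (k + 2) * e l) -
    (e (k + l + 2 - N) * e ((N : ℤ) - 3) + e (k + l + 1 - N) * e ((N : ℤ) - 2)) *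
      (e k * e (l + 1) - e (k + 2) * e (l - 1)) +
    (e (k + l + 3 - N) * e ((N : ℤ) - 3) + e (k + l + 2 - N) * e ((N : ℤ) - 2) +
      e (k + l + 1 - N) * e ((N : ℤ) - 1)) * (e k * e l - e (k + 1) * e (l - 1)) +
    (e (k + l + 2 - N) * e ((N : ℤ) - 2)) * (e (k - 1) * e (l + 1) - e (k + 2) * e (l - 2)) -
    (e (k + l + 3 - N) * e ((N : ℤ) - 2) + e (k + l + 2 - N) * e ((N : ℤ) - 1)) *
      (e (k - 1) * e l - e (k + 1) * e (l - 2)) +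
    (e (k + l + 3 - N) * e ((N : ℤ) - 1)) * (e (k - 1) * e (l - 1) - e k * e (l - 2)) := by
  induction N with
  | zero => simp [he]
  | succ N ih =>
    rw [Finset.sum_range_succ, ih, det_fin_four]
    simp only [Matrix.of_apply, Matrix.cons_val]
    push_cast
    ring_nf

theorem jacobiTrudiDet_pair {R : Type*} [CommRing R] (x : ℕ → R) (m : ℕ) (k : ℕ) :
    jacobiTrudiDet x m (fun i => ((![k, k] i : ℕ) : ℤ)) =
      elemSymm x m k ^ 2 - elemSymm x m (k + 1) * elemSymm x m (k - 1) := by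
  rw [jacobiTrudiDet, Matrix.det_fin_two]
  simp
  ring_nf

/-- The determinantal form of the Schur expansion of
`s_{(2^k)} s_{(2^l)} - s_{(2^{k+1})} s_{(2^{l-1})}`, over the shapes with
column lengths `k+l-a, k, l, a` for `0 ≤ a ≤ l`. -/
theorem sum_jacobiTrudiDet {R : Type*} [CommRing R] (x : ℕ → R) (m : ℕ) (k l : ℕ) (hl : 1 ≤ l) :
    ∑ a ∈ Finset.range (l + 1), jacobiTrudiDet x m (fun i => ((![k + l - a, k, l, a] i : ℕ) : ℤ)) =
      jacobiTrudiDet x m (fun i => ((![k, k] i : ℕ) : ℤ)) *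
        jacobiTrudiDet x m (fun i => ((![l, l] i : ℕ) : ℤ)) -
      jacobiTrudiDet x m (fun i => ((![k + 1, k + 1] i : ℕ) : ℤ)) *
        jacobiTrudiDet x m (fun i => ((![l - 1, l - 1] i : ℕ) : ℤ)) := by
  have h := sum_range_det_eq (elemSymm x m) (fun j => elemSymm_of_neg x m) k l (l + 1)
  have h1 : ∀ a ∈ Finset.range (l + 1),
      jacobiTrudiDet x m (fun i => ((![k + l - a, k, l, a] i : ℕ) : ℤ)) =
      jacobiTrudiDet x m (![(k : ℤ) + l - a, k, l, a]) := by
    intro a ha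
    have : a ≤ l := by simpa [Nat.lt_succ_iff] using ha
    congr 1
    ext i
    fin_cases i <;> simp
    omega
  rw [Finset.sum_congr rfl h1]
  simp only [jacobiTrudiDet_pair]
  have h3 : (((l - 1 : ℕ) : ℤ)) = l - 1 := by omega
  rw [h3]
  refine Eq.trans (Finset.sum_congr rfl fun a _ => ?_) (h.trans ?_)
  · refine congrArg Matrix.det ?_
    ext i j
    fin_cases i <;> fin_cases j <;> simp <;> ring_nf
  · push_cast
    ring_nf

/-! ### The branching rule for semistandard tableaux -/

/-- The restriction of a tableau to a smaller diagram. -/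
def restrictTableau {μ ν : YoungDiagram} (h : ν ≤ μ) (T : SemistandardYoungTableau μ) :
    SemistandardYoungTableau ν where
  entry i j := if (i, j) ∈ ν then T i j else 0
  row_weak' {i j₁ j₂} hj hc := by
    rw [if_pos hc, if_pos (ν.up_left_mem le_rfl hj.le hc)]
    exact T.row_weak hj (h hc)
  col_strict' {i₁ i₂ j} hi hc := by
    rw [if_pos hc, if_pos (ν.up_left_mem hi.le le_rfl hc)]
    exact T.col_strict hi (h hc)
  zeros' hc := if_neg hc

/-- The extension of a tableau with entries below `m` by a horizontal strip of cells with
entry `m`. -/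
def extendTableau {μ ν : YoungDiagram} (m : ℕ) (h : ν ≤ μ)
    (hstrip : ∀ {i₁ i₂ j : ℕ}, i₁ < i₂ → (i₂, j) ∈ μ → (i₁, j) ∈ ν)
    (T : SemistandardYoungTableau ν) (hT : ∀ c ∈ ν.cells, T c.1 c.2 < m) :
    SemistandardYoungTableau μ where
  entry i j := if (i, j) ∈ ν then T i j else if (i, j) ∈ μ then m else 0
  row_weak' {i j₁ j₂} hj hc := by
    by_cases h₂ : (i, j₂) ∈ ν
    · rw [if_pos h₂, if_pos (ν.up_left_mem le_rfl hj.le h₂)]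
      exact T.row_weak hj h₂
    · rw [if_neg h₂, if_pos hc]
      split_ifs with h₁ h₁
      · exact (hT (i, j₁) h₁).le
      · exact le_rfl
      · exact Nat.zero_le m
  col_strict' {i₁ i₂ j} hi hc := by
    rw [if_pos (hstrip hi hc)]
    split_ifs with h₂
    · exact T.col_strict hi h₂
    · exact hT (i₁, j) (hstrip hi hc)
  zeros' {i j} hc := by
    rw [if_neg fun hν => hc (h hν), if_neg hc]

theorem restrictTableau_apply {μ ν : YoungDiagram} (h : ν ≤ μ) (T : SemistandardYoungTableau μ)
    (i j : ℕ) : restrictTableau h T i j = if (i, j) ∈ ν then T i j else 0 := rfl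

theorem extendTableau_apply {μ ν : YoungDiagram} (m : ℕ) (h : ν ≤ μ)
    (hstrip : ∀ {i₁ i₂ j : ℕ}, i₁ < i₂ → (i₂, j) ∈ μ → (i₁, j) ∈ ν)
    (T : SemistandardYoungTableau ν) (hT : ∀ c ∈ ν.cells, T c.1 c.2 < m) (i j : ℕ) :
    extendTableau m h hstrip T hT i j =
      if (i, j) ∈ ν then T i j else if (i, j) ∈ μ then m else 0 := rfl

/-- The Young diagram with column lengths `c₀ ≥ c₁ ≥ ⋯ ≥ c_{n-1}`. -/
def colDiagram {n : ℕ} (c : Fin n → ℕ) (hc : Antitone c) : YoungDiagram where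
  cells := Finset.univ.biUnion fun j : Fin n => (Finset.range (c j)).image fun i => (i, (j : ℕ))
  isLowerSet := by
    rintro ⟨a, b⟩ ⟨i, j⟩ ⟨h₁, h₂⟩ h
    simp only [Finset.coe_biUnion, Set.mem_iUnion, Finset.coe_image, Set.mem_image,
      Finset.coe_range, Set.mem_Iio, Prod.mk.injEq, Finset.mem_coe, Finset.mem_univ,
      exists_prop, true_and] at h ⊢
    obtain ⟨b', a', ha, rfl, rfl⟩ := h
    simp only at h₁ h₂
    refine ⟨⟨j, h₂.trans_lt b'.2⟩, i, ?_, rfl, rfl⟩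
    exact (h₁.trans_lt ha).trans_le (hc h₂)

theorem mem_colDiagram {n : ℕ} {c : Fin n → ℕ} {hc : Antitone c} {i j : ℕ} :
    (i, j) ∈ colDiagram c hc ↔ ∃ h : j < n, i < c ⟨j, h⟩ := by
  rw [← YoungDiagram.mem_cells]
  simp only [colDiagram, Finset.mem_biUnion, Finset.mem_univ, Finset.mem_image, Finset.mem_range,
    Prod.mk.injEq, true_and]
  constructor
  · rintro ⟨j, a, ha, rfl, rfl⟩
    exact ⟨j.2, ha⟩
  · rintro ⟨h, hi⟩
    exact ⟨⟨j, h⟩, i, hi, rfl, rfl⟩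

theorem mem_colDiagram_fin {n : ℕ} {c : Fin n → ℕ} {hc : Antitone c} {i : ℕ} {j : Fin n} :
    (i, (j : ℕ)) ∈ colDiagram c hc ↔ i < c j := by
  rw [mem_colDiagram]
  exact ⟨fun ⟨_, h⟩ => h, fun h => ⟨j.2, h⟩⟩

theorem prod_cells_colDiagram {M : Type*} [CommMonoid M] {n : ℕ} (c : Fin n → ℕ)
    (hc : Antitone c) (f : ℕ × ℕ → M) :
    ∏ p ∈ (colDiagram c hc).cells, f p = ∏ j : Fin n, ∏ i ∈ Finset.range (c j), f (i, j) := by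
  rw [colDiagram, Finset.prod_biUnion]
  · refine Finset.prod_congr rfl fun j _ => ?_
    rw [Finset.prod_image]
    intro a _ b _ h
    exact (Prod.mk.inj h).1
  · intro a _ b _ hab
    rw [Function.onFun, Finset.disjoint_left]
    simp only [Finset.mem_image, not_exists, not_and]
    rintro p ⟨i, _, rfl⟩ i' _ h
    exact hab (Fin.ext (Prod.mk.inj h).2.symm)

/-- The columns of the diagram whose last entry is `m`; empty columns, whose last cell `c j - 1`
would be a junk value, are excluded. -/
def topColumns {n : ℕ} {c : Fin n → ℕ} {hc : Antitone c} (m : ℕ)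
    (T : SemistandardYoungTableau (colDiagram c hc)) : Finset (Fin n) :=
  Finset.univ.filter fun j => 0 < c j ∧ T (c j - 1) j = m

/-- The cells left after removing one cell from each column in `topColumns m T` are those with
entry below `m`. -/
theorem lt_sub_topColumns_iff {n : ℕ} {c : Fin n → ℕ} {hc : Antitone c} {m : ℕ}
    {T : SemistandardYoungTableau (colDiagram c hc)}
    (hT : ∀ p ∈ (colDiagram c hc).cells, T p.1 p.2 < m + 1) {i : ℕ} {j : Fin n} :
    i < c j - (if j ∈ topColumns m T then 1 else 0) ↔ i < c j ∧ T i j < m := by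
  have hmem : j ∈ topColumns m T ↔ 0 < c j ∧ T (c j - 1) j = m := by simp [topColumns]
  by_cases hj : j ∈ topColumns m T
  · rw [if_pos hj]
    obtain ⟨h₀, h₁⟩ := hmem.1 hj
    refine ⟨fun h => ⟨by omega, ?_⟩, fun ⟨h, h'⟩ => ?_⟩
    · rw [← h₁]
      exact T.col_strict h (mem_colDiagram_fin.2 (by omega))
    · by_contra h₂
      have : i = c j - 1 := by omega
      rw [this, h₁] at h'
      exact lt_irrefl _ h'
  · rw [if_neg hj, Nat.sub_zero]
    refine ⟨fun h => ⟨h, ?_⟩, fun h => h.1⟩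
    have h₁ : (c j - 1, (j : ℕ)) ∈ colDiagram c hc := mem_colDiagram_fin.2 (by omega)
    have h₂ : T i j ≤ T (c j - 1) j := T.col_weak (by omega) h₁
    have h₃ := hT _ h₁
    simp only at h₃
    have h₄ : T (c j - 1) j ≠ m := fun h₄ => hj (hmem.2 ⟨by omega, h₄⟩)
    omega

theorem antitone_sub_topColumns {n : ℕ} {c : Fin n → ℕ} {hc : Antitone c} {m : ℕ}
    {T : SemistandardYoungTableau (colDiagram c hc)}
    (hT : ∀ p ∈ (colDiagram c hc).cells, T p.1 p.2 < m + 1) :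
    Antitone fun j => c j - (if j ∈ topColumns m T then 1 else 0) := by
  intro a b hab
  refine le_of_forall_lt fun i hi => ?_
  rw [lt_sub_topColumns_iff hT] at hi ⊢
  exact ⟨hi.1.trans_le (hc hab),
    (T.row_weak_of_le hab (mem_colDiagram_fin.2 hi.1)).trans_lt hi.2⟩

theorem schurEval_eq_sum_prod_cells {R : Type*} [CommRing R] (μ : YoungDiagram) (x : ℕ → R)
    (m : ℕ) :
    schurEval μ (fun i : Fin m => x i) =
      ∑ T : {T : SemistandardYoungTableau μ // ∀ c ∈ μ.cells, T c.1 c.2 < m},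
        ∏ p ∈ μ.cells, x (T.1 p.1 p.2) :=
  Finset.sum_congr rfl fun T _ => Finset.prod_coe_sort μ.cells fun p => x (T.1 p.1 p.2)

/-- The tableaux in which the entry `m` occurs exactly in the columns `S` correspond to the
tableaux with smaller entries on the diagram with the last cell of each of these columns removed.
By `hpos` the subtraction in the column lengths does not truncate. -/
theorem sum_topColumns_eq {R : Type*} [CommRing R] {n : ℕ} (c : Fin n → ℕ) (hc : Antitone c)
    (x : ℕ → R) (m : ℕ) (S : Finset (Fin n))
    (hS : Antitone fun j => c j - (if j ∈ S then 1 else 0)) (hpos : ∀ j ∈ S, 0 < c j) :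
    ∑ T : {T : SemistandardYoungTableau (colDiagram c hc) //
        ∀ p ∈ (colDiagram c hc).cells, T p.1 p.2 < m + 1} with topColumns m T.1 = S,
      ∏ p ∈ (colDiagram c hc).cells, x (T.1 p.1 p.2) =
    x m ^ S.card * schurEval (colDiagram _ hS) (fun i : Fin m => x i) := by
  have hle : colDiagram _ hS ≤ colDiagram c hc := by
    rintro ⟨i, j⟩ h
    obtain ⟨hj, hi⟩ := mem_colDiagram.1 h
    exact mem_colDiagram.2 ⟨hj, hi.trans_le (Nat.sub_le _ _)⟩
  have hstrip : ∀ {i₁ i₂ j : ℕ}, i₁ < i₂ → (i₂, j) ∈ colDiagram c hc →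
      (i₁, j) ∈ colDiagram _ hS := by
    intro i₁ i₂ j hi h
    obtain ⟨hj, h⟩ := mem_colDiagram.1 h
    refine mem_colDiagram.2 ⟨hj, ?_⟩
    split_ifs <;> omega
  have hmem : ∀ T : {T : SemistandardYoungTableau (colDiagram c hc) //
      ∀ p ∈ (colDiagram c hc).cells, T p.1 p.2 < m + 1}, topColumns m T.1 = S →
      ∀ i j, (i, j) ∈ colDiagram _ hS ↔ (i, j) ∈ colDiagram c hc ∧ T.1 i j < m := by
    rintro T rfl i j
    constructor
    · intro h
      obtain ⟨hj, h⟩ := mem_colDiagram.1 h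
      obtain ⟨h₁, h₂⟩ := (lt_sub_topColumns_iff T.2).1 h
      exact ⟨mem_colDiagram.2 ⟨hj, h₁⟩, h₂⟩
    · rintro ⟨h, h₂⟩
      obtain ⟨hj, h₁⟩ := mem_colDiagram.1 h
      exact mem_colDiagram.2 ⟨hj, (lt_sub_topColumns_iff T.2).2 ⟨h₁, h₂⟩⟩
  rw [schurEval_eq_sum_prod_cells, Finset.mul_sum]
  refine Finset.sum_bij'
    (fun T hT => ⟨restrictTableau hle T.1, fun p hp => by
      rw [restrictTableau_apply, if_pos ((YoungDiagram.mem_cells _).1 hp)]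
      exact ((hmem T (Finset.mem_filter.1 hT).2 _ _).1 hp).2⟩)
    (fun T _ => ⟨extendTableau m hle hstrip T.1 T.2, fun p hp => by
      rw [extendTableau_apply]
      split_ifs with h₁
      · exact (T.2 p h₁).trans (Nat.lt_succ_self m)
      · exact Nat.lt_succ_self m
      · exact Nat.succ_pos m⟩)
    (fun T hT => Finset.mem_univ _) ?_ ?_ ?_ ?_
  · intro T _
    rw [Finset.mem_filter]
    refine ⟨Finset.mem_univ _, ?_⟩
    ext j
    simp only [topColumns, Finset.mem_filter, Finset.mem_univ, true_and, extendTableau_apply,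
      mem_colDiagram_fin]
    by_cases hj : j ∈ S
    · have := hpos j hj
      simp [hj, this]
    · simp only [hj, if_false, Nat.sub_zero, iff_false, not_and]
      intro h₀
      have h₁ : c j - 1 < c j := by omega
      rw [if_pos h₁]
      refine (T.2 (c j - 1, j) (mem_colDiagram_fin.2 ?_)).ne
      simpa [hj] using h₁
  · intro T hT
    apply Subtype.ext
    ext i j
    have h := hmem T (Finset.mem_filter.1 hT).2 i j
    simp only [extendTableau_apply, restrictTableau_apply]
    split_ifs with h₁ h₂
    · rfl
    · have h₃ := T.2 (i, j) h₂
      have h₄ : ¬ T.1 i j < m := fun h₄ => h₁ (h.2 ⟨h₂, h₄⟩)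
      simp only at h₃
      omega
    · exact (T.1.zeros h₂).symm
  · intro T _
    apply Subtype.ext
    ext i j
    simp only [extendTableau_apply, restrictTableau_apply]
    split_ifs with h₁
    · rfl
    · exact (T.1.zeros h₁).symm
  · intro T hT
    have hTS := (Finset.mem_filter.1 hT).2
    have hcard : x m ^ S.card = ∏ j, if j ∈ S then x m else 1 := by simp [Finset.prod_ite_mem]
    rw [prod_cells_colDiagram c hc (fun p => x (T.1 p.1 p.2)),
      prod_cells_colDiagram _ hS (fun p => x (restrictTableau hle T.1 p.1 p.2)), hcard,
      ← Finset.prod_mul_distrib]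
    refine Finset.prod_congr rfl fun j _ => ?_
    have hres : ∏ i ∈ Finset.range (c j - if j ∈ S then 1 else 0),
        x (restrictTableau hle T.1 i j) =
        ∏ i ∈ Finset.range (c j - if j ∈ S then 1 else 0), x (T.1 i j) := by
      refine Finset.prod_congr rfl fun i hi => ?_
      rw [restrictTableau_apply, if_pos (mem_colDiagram_fin.2 (Finset.mem_range.1 hi))]
    rw [hres]
    by_cases hj : j ∈ S
    · rw [if_pos hj, if_pos hj]
      have hj' : j ∈ topColumns m T.1 := hTS ▸ hj
      simp only [topColumns, Finset.mem_filter, Finset.mem_univ, true_and] at hj'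
      obtain ⟨d, hd⟩ : ∃ d, c j = d + 1 := ⟨c j - 1, by omega⟩
      rw [hd, Nat.add_sub_cancel] at hj'
      rw [hd, Nat.add_sub_cancel, Finset.prod_range_succ, hj'.2, mul_comm]
    · simp [hj]

/-- The dual Jacobi–Trudi identity: a Schur polynomial is the determinant of elementary symmetric
polynomials given by the column lengths of its diagram. Both sides satisfy the same recursion in
the number of variables. -/
theorem schurEval_colDiagram {R : Type*} [CommRing R] {n : ℕ} (x : ℕ → R) (m : ℕ)
    (c : Fin n → ℕ) (hc : Antitone c) :
    schurEval (colDiagram c hc) (fun i : Fin m => x i) =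
      jacobiTrudiDet x m (fun i => (c i : ℤ)) := by
  induction m generalizing c with
  | zero =>
    rw [jacobiTrudiDet_zero x c hc, schurEval_eq_sum_prod_cells]
    split_ifs with h
    · have hempty : (colDiagram c hc).cells = ∅ := by
        refine Finset.eq_empty_of_forall_notMem ?_
        rintro ⟨i, j⟩ hp
        obtain ⟨hj, hi⟩ := mem_colDiagram.1 ((YoungDiagram.mem_cells _).1 hp)
        simp [h] at hi
      have : Unique {T : SemistandardYoungTableau (colDiagram c hc) //
          ∀ p ∈ (colDiagram c hc).cells, T p.1 p.2 < 0} :=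
        { default := ⟨default, by simp [hempty]⟩
          uniq := fun T => Subtype.ext (SemistandardYoungTableau.ext fun i j => by
            have hij : (i, j) ∉ colDiagram c hc := by
              rw [← YoungDiagram.mem_cells, hempty]
              simp
            rw [T.1.zeros hij, SemistandardYoungTableau.zeros _ hij]) }
      rw [Fintype.sum_unique]
      exact Finset.prod_eq_one fun p hp => absurd (hempty ▸ hp) (Finset.notMem_empty p)
    · obtain ⟨j, hj⟩ := Function.ne_iff.1 h
      refine Finset.sum_eq_zero fun T _ => ?_
      have := T.2 (0, j) (mem_colDiagram_fin.2 (Nat.pos_of_ne_zero hj))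
      exact absurd this (Nat.not_lt_zero _)
  | succ m ih =>
    rw [jacobiTrudiDet_succ, schurEval_eq_sum_prod_cells,
      ← Finset.sum_fiberwise _ (fun T => topColumns m T.1)]
    refine Finset.sum_congr rfl fun S _ => ?_
    by_cases hS : (Antitone fun j => c j - (if j ∈ S then 1 else 0)) ∧ ∀ j ∈ S, 0 < c j
    · rw [sum_topColumns_eq c hc x m S hS.1 hS.2, ih _ hS.1]
      congr 2
      ext j
      have := hS.2 j
      split_ifs with hj
      · have := this hj
        omega
      · simp
    · rw [(jacobiTrudiDet_eq_zero_or x m c hc S).resolve_left hS, mul_zero]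
      refine Finset.sum_eq_zero fun T hT => absurd ?_ hS
      obtain rfl := (Finset.mem_filter.1 hT).2
      refine ⟨antitone_sub_topColumns T.2, fun j hj => ?_⟩
      simp only [topColumns, Finset.mem_filter] at hj
      exact hj.2.1

/-! ### Schur functions as power series -/

theorem prod_cells_X_eq_monomial {μ : YoungDiagram} (T : SemistandardYoungTableau μ) :
    ∏ p ∈ μ.cells, (MvPowerSeries.X (T p.1 p.2) : MvPowerSeries ℕ ℤ) =
      MvPowerSeries.monomial (tableauType T) 1 := by
  rw [tableauType]
  induction μ.cells using Finset.induction_on with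
  | empty => rfl
  | insert p s hp ih =>
    rw [Finset.prod_insert hp, Finset.sum_insert hp, ih, MvPowerSeries.X,
      MvPowerSeries.monomial_mul_monomial, one_mul]

theorem mem_support_tableauType {μ : YoungDiagram} (T : SemistandardYoungTableau μ)
    {p : ℕ × ℕ} (hp : p ∈ μ.cells) : T p.1 p.2 ∈ (tableauType T).support := by
  rw [Finsupp.mem_support_iff, tableauType, Finsupp.finsetSum_apply]
  intro h
  simpa using Finset.sum_eq_zero_iff.1 h p hp

/-- A Schur function and its truncation to `m` variables have the same coefficients at the
monomials in these variables. -/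
theorem coeff_schurEval_X (μ : YoungDiagram) (m : ℕ) (α : ℕ →₀ ℕ) (hα : ∀ i ∈ α.support, i < m) :
    MvPowerSeries.coeff α
      (schurEval μ (fun i : Fin m => (MvPowerSeries.X (i : ℕ) : MvPowerSeries ℕ ℤ))) =
    MvPowerSeries.coeff α (schurFunction μ) := by
  rw [schurEval_eq_sum_prod_cells μ MvPowerSeries.X m, map_sum]
  simp only [prod_cells_X_eq_monomial, MvPowerSeries.coeff_monomial]
  rw [Finset.sum_boole]
  change _ = (Nat.card {T : SemistandardYoungTableau μ // tableauType T = α} : ℤ)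
  rw [← Fintype.card_subtype, ← Nat.card_eq_fintype_card]
  congr 1
  refine Nat.card_congr ⟨fun T => ⟨T.1.1, T.2.symm⟩, fun T => ⟨⟨T.1, fun p hp => ?_⟩, T.2.symm⟩,
    fun _ => rfl, fun _ => rfl⟩
  have h := mem_support_tableauType T.1 hp
  rw [T.2] at h
  exact hα _ h

theorem coeff_mul_congr_of_support {f g F G : MvPowerSeries ℕ ℤ} (m : ℕ)
    (hf : ∀ α : ℕ →₀ ℕ, (∀ i ∈ α.support, i < m) →
      MvPowerSeries.coeff α f = MvPowerSeries.coeff α F)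
    (hg : ∀ α : ℕ →₀ ℕ, (∀ i ∈ α.support, i < m) →
      MvPowerSeries.coeff α g = MvPowerSeries.coeff α G)
    (α : ℕ →₀ ℕ) (hα : ∀ i ∈ α.support, i < m) :
    MvPowerSeries.coeff α (f * g) = MvPowerSeries.coeff α (F * G) := by
  rw [MvPowerSeries.coeff_mul, MvPowerSeries.coeff_mul]
  refine Finset.sum_congr rfl fun p hp => ?_
  rw [Finset.HasAntidiagonal.mem_antidiagonal] at hp
  rw [hf p.1 fun i hi => hα i ?_, hg p.2 fun i hi => hα i ?_]
  · exact Finsupp.support_mono (hp ▸ le_add_self) hi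
  · exact Finsupp.support_mono (hp ▸ le_self_add) hi

theorem schurPositive_sum {ι : Type*} (s : Finset ι) (μ : ι → YoungDiagram) :
    SchurPositive (∑ a ∈ s, schurFunction (μ a)) := by
  classical
  refine ⟨∑ a ∈ s, Finsupp.single (μ a) 1, fun ν => ?_, ?_⟩
  · rw [Finsupp.finsetSum_apply]
    refine Finset.sum_nonneg fun a _ => ?_
    rw [Finsupp.single_apply]
    split_ifs <;> norm_num
  · have h := Finsupp.linearCombination_apply ℤ (v := schurFunction)
      (∑ a ∈ s, Finsupp.single (μ a) (1 : ℤ))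
    rw [← h, map_sum]
    simp

/-! ### Schur positivity for two-column shapes -/

theorem antitone_pair (k : ℕ) : Antitone ![k, k] := by
  refine Fin.antitone_iff_succ_le.2 fun i => ?_
  fin_cases i
  simp

theorem antitone_quad {k l : ℕ} (h : l ≤ k) (a : Fin (l + 1)) :
    Antitone ![k + l - a, k, l, (a : ℕ)] := by
  refine Fin.antitone_iff_succ_le.2 fun i => ?_
  have := a.is_le
  fin_cases i <;> simp <;> omega

theorem twoColumn_eq_colDiagram (k : ℕ) : twoColumn k = colDiagram ![k, k] (antitone_pair k) := by
  apply YoungDiagram.ext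
  ext ⟨i, j⟩
  rw [YoungDiagram.mem_cells, YoungDiagram.mem_cells, mem_colDiagram, ← YoungDiagram.mem_cells]
  simp only [twoColumn, Finset.mem_product, Finset.mem_range]
  constructor
  · rintro ⟨hi, hj⟩
    refine ⟨hj, ?_⟩
    interval_cases j <;> simpa using hi
  · rintro ⟨hj, hi⟩
    refine ⟨?_, hj⟩
    interval_cases j <;> simpa using hi

theorem schurEval_twoColumn {R : Type*} [CommRing R] (x : ℕ → R) (m k : ℕ) :
    schurEval (twoColumn k) (fun i : Fin m => x i) =
      elemSymm x m k ^ 2 - elemSymm x m (k + 1) * elemSymm x m (k - 1) := by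
  rw [twoColumn_eq_colDiagram, schurEval_colDiagram, jacobiTrudiDet_pair]

/-- The Schur expansion of the difference of products, in finitely many variables. -/
theorem schurEval_twoColumn_mul_sub {R : Type*} [CommRing R] (x : ℕ → R) (m : ℕ) {k l : ℕ}
    (hl : 1 ≤ l) (hlk : l ≤ k) :
    schurEval (twoColumn k) (fun i : Fin m => x i) *
        schurEval (twoColumn l) (fun i : Fin m => x i) -
      schurEval (twoColumn (k + 1)) (fun i : Fin m => x i) *
        schurEval (twoColumn (l - 1)) (fun i : Fin m => x i) =
    ∑ a : Fin (l + 1), schurEval (colDiagram _ (antitone_quad hlk a)) (fun i : Fin m => x i) := by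
  simp only [twoColumn_eq_colDiagram, schurEval_colDiagram]
  rw [← sum_jacobiTrudiDet x m k l hl, Finset.sum_range]

theorem schurFunction_twoColumn_mul_sub {k l : ℕ} (hl : 1 ≤ l) (hlk : l ≤ k) :
    schurFunction (twoColumn k) * schurFunction (twoColumn l) -
      schurFunction (twoColumn (k + 1)) * schurFunction (twoColumn (l - 1)) =
    ∑ a : Fin (l + 1), schurFunction (colDiagram _ (antitone_quad hlk a)) := by
  ext α
  -- Only finitely many variables occur in `x^α` and in its divisors.
  set m := α.support.sup id + 1
  have hα : ∀ i ∈ α.support, i < m := fun i hi => Nat.lt_succ_of_le (Finset.le_sup (f := id) hi)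
  have h := congrArg (MvPowerSeries.coeff α)
    (schurEval_twoColumn_mul_sub (MvPowerSeries.X : ℕ → MvPowerSeries ℕ ℤ) m hl hlk)
  have hc := fun μ => coeff_schurEval_X μ m
  rw [map_sub, map_sum, coeff_mul_congr_of_support m (hc _) (hc _) α hα,
    coeff_mul_congr_of_support m (hc _) (hc _) α hα,
    Finset.sum_congr rfl fun a _ => hc _ α hα] at h
  rw [map_sub, map_sum, h]

theorem coeff_schurEval_X_pow_nonneg (μ : YoungDiagram) (m i : ℕ) :
    0 ≤ (schurEval μ (fun i : Fin m => (Polynomial.X : Polynomial ℝ) ^ ((i : ℕ) + 1))).coeff i := by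
  rw [schurEval, Polynomial.finsetSum_coeff]
  refine Finset.sum_nonneg fun T _ => ?_
  rw [Finset.prod_pow_eq_pow_sum, Polynomial.coeff_X_pow]
  split_ifs <;> norm_num

/-! ### `q`-binomial coefficients and `q`-Narayana numbers -/

theorem one_sub_ratFuncX_pow_ne_zero (k : ℕ) : (1 : RatFunc ℝ) - RatFunc.X ^ (k + 1) ≠ 0 := by
  have h : (1 : RatFunc ℝ) - RatFunc.X ^ (k + 1) =
      algebraMap (Polynomial ℝ) (RatFunc ℝ) (1 - Polynomial.X ^ (k + 1)) := by
    simp [RatFunc.algebraMap_X]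
  rw [h]
  refine RatFunc.algebraMap_ne_zero fun h0 => ?_
  simpa using congrArg (Polynomial.eval 0) h0

theorem qInt_succ_ne_zero (k : ℕ) : qInt (k + 1) ≠ 0 :=
  div_ne_zero (one_sub_ratFuncX_pow_ne_zero k) (by simpa using one_sub_ratFuncX_pow_ne_zero 0)

theorem qFactorial_succ (k : ℕ) : qFactorial (k + 1) = qFactorial k * qInt (k + 1) :=
  Finset.prod_range_succ _ _

theorem qFactorial_ne_zero (k : ℕ) : qFactorial k ≠ 0 :=
  Finset.prod_ne_zero_iff.2 fun i _ => qInt_succ_ne_zero i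

theorem qFactorial_one : qFactorial 1 = 1 := by
  rw [qFactorial, Finset.prod_range_one, qInt, pow_one]
  exact div_self (by simpa using one_sub_ratFuncX_pow_ne_zero 0)

theorem qInt_add (a b : ℕ) : qInt (a + b) = qInt a + RatFunc.X ^ a * qInt b := by
  simp only [qInt]
  ring

/-- `[a+1][b+1] - q[a][b] = [a+b+1]`. -/
theorem qInt_succ_mul_qInt_succ (a b : ℕ) :
    qInt (a + 1) * qInt (b + 1) = qInt (a + b + 1) + RatFunc.X * (qInt a * qInt b) := by
  have h : (1 : RatFunc ℝ) - RatFunc.X ≠ 0 := by simpa using one_sub_ratFuncX_pow_ne_zero 0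
  simp only [qInt]
  field_simp
  ring

theorem qBinomial_add (a b : ℕ) :
    qBinomial (a + b) a = qFactorial (a + b) / (qFactorial a * qFactorial b) := by
  rw [qBinomial, if_pos (Nat.le_add_right a b), Nat.add_sub_cancel_left]

theorem qBinomial_of_lt {n j : ℕ} (h : n < j) : qBinomial n j = 0 :=
  if_neg h.not_ge

theorem qBinomial_self (n : ℕ) : qBinomial n n = 1 := by
  have := qFactorial_ne_zero n
  have h0 : qFactorial 0 = 1 := Finset.prod_range_zero _
  rw [qBinomial, if_pos le_rfl, Nat.sub_self, h0, mul_one, div_self this]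

theorem qBinomial_zero (n : ℕ) : qBinomial n 0 = 1 := by
  have := qFactorial_ne_zero n
  have h0 : qFactorial 0 = 1 := Finset.prod_range_zero _
  rw [qBinomial, if_pos (Nat.zero_le n), Nat.sub_zero, h0, one_mul, div_self this]

/-- The `q`-Pascal rule in the form that matches the recursion for `e_j(q, …, q^M)` on adjoining
the variable `q^{M+1}`. -/
theorem qBinomial_succ_succ {M j : ℕ} (h : j ≤ M) :
    qBinomial (M + 1) (j + 1) = qBinomial M (j + 1) + RatFunc.X ^ (M - j) * qBinomial M j := by
  obtain ⟨r, rfl⟩ := Nat.exists_eq_add_of_le h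
  cases r with
  | zero => simp [qBinomial_self, qBinomial_of_lt]
  | succ r =>
    have e1 := qBinomial_add (j + 1) (r + 1)
    have e2 := qBinomial_add (j + 1) r
    have e3 := qBinomial_add j (r + 1)
    have e4 := qInt_add (r + 1) (j + 1)
    rw [show j + 1 + (r + 1) = j + (r + 1) + 1 by ring] at e1
    rw [show j + 1 + r = j + (r + 1) by ring] at e2
    rw [show r + 1 + (j + 1) = j + (r + 1) + 1 by ring] at e4
    rw [e1, e2, e3, Nat.add_sub_cancel_left, qFactorial_succ (j + (r + 1)), qFactorial_succ j,
      qFactorial_succ r, e4]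
    have h1 := qFactorial_ne_zero j
    have h2 := qFactorial_ne_zero r
    have h3 := qInt_succ_ne_zero j
    have h4 := qInt_succ_ne_zero r
    field_simp

theorem map_elemSymm {R S : Type*} [CommRing R] [CommRing S] (f : R →+* S) (x : ℕ → R) (m : ℕ)
    (j : ℤ) : f (elemSymm x m j) = elemSymm (fun i => f (x i)) m j := by
  induction m generalizing j with
  | zero =>
    simp only [elemSymm]
    split_ifs <;> simp
  | succ m ih => simp [elemSymm, ih]

/-- The `q`-binomial theorem: `e_j(q, …, q^M) = q^{j(j+1)/2} [M choose j]`. -/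
theorem elemSymm_ratFuncX_pow (M j : ℕ) :
    elemSymm (fun i => (RatFunc.X : RatFunc ℝ) ^ (i + 1)) M j =
      RatFunc.X ^ (j + 1).choose 2 * qBinomial M j := by
  induction M generalizing j with
  | zero =>
    cases j with
    | zero => simp [elemSymm, qBinomial_zero]
    | succ j =>
      rw [qBinomial_of_lt (Nat.succ_pos j), mul_zero, elemSymm, if_neg (by omega)]
  | succ M ih =>
    cases j with
    | zero => simp [elemSymm_zero, qBinomial_zero]
    | succ j =>
      rw [elemSymm, ih, Nat.cast_succ, add_sub_cancel_right, ih]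
      have hT : (j + 1 + 1).choose 2 = (j + 1).choose 2 + (j + 1) := by
        rw [Nat.choose_succ_succ' (j + 1) 1, Nat.choose_one_right, add_comm]
      rcases le_or_gt j M with h | h
      · rw [qBinomial_succ_succ h, hT, mul_add, ← mul_assoc, ← mul_assoc, ← pow_add, ← pow_add]
        congr 3
        omega
      · rw [qBinomial_of_lt h, qBinomial_of_lt (h.trans (Nat.lt_succ_self j)),
          qBinomial_of_lt (Nat.succ_lt_succ h)]
        simp

theorem two_mul_choose_two (k : ℕ) : 2 * (k + 1).choose 2 = k ^ 2 + k := by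
  induction k with
  | zero => rfl
  | succ k ih =>
    rw [Nat.choose_succ_succ' (k + 1) 1, Nat.choose_one_right, mul_add, ih]
    ring

/-- `N_q(n,k) = e_k² - e_{k+1} e_{k-1}` at `q, q², …, q^{n-1}`. -/
theorem qNarayana_succ_eq (M k : ℕ) :
    qNarayana (M + 1) k =
      elemSymm (fun i => (RatFunc.X : RatFunc ℝ) ^ (i + 1)) M k ^ 2 -
        elemSymm (fun i => (RatFunc.X : RatFunc ℝ) ^ (i + 1)) M (k + 1) *
          elemSymm (fun i => (RatFunc.X : RatFunc ℝ) ^ (i + 1)) M (k - 1) := by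
  have hn := qInt_succ_ne_zero M
  have hN := qFactorial_ne_zero M
  cases k with
  | zero =>
    have h1 : qBinomial (M + 1) 1 = qInt (M + 1) := by
      have h2 := qBinomial_add 1 M
      rw [add_comm 1 M, qFactorial_succ, qFactorial_one, one_mul, mul_div_cancel_left₀ _ hN] at h2
      exact h2
    rw [Nat.cast_zero, elemSymm_zero, elemSymm_of_neg _ _ (show (0 : ℤ) - 1 < 0 by norm_num)]
    rw [qNarayana, qBinomial_zero, zero_add, h1]
    field_simp
    simp
  | succ j =>
    have hsucc : ((j + 1 : ℕ) : ℤ) + 1 = ((j + 2 : ℕ) : ℤ) := by push_cast; ring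
    have hpred : ((j + 1 : ℕ) : ℤ) - 1 = (j : ℤ) := by push_cast; ring
    have hT : (j + 2).choose 2 = (j + 1).choose 2 + (j + 1) := by
      rw [Nat.choose_succ_succ' (j + 1) 1, Nat.choose_one_right, add_comm]
    have hT' : (j + 3).choose 2 = (j + 2).choose 2 + (j + 2) := by
      rw [Nat.choose_succ_succ' (j + 2) 1, Nat.choose_one_right, add_comm]
    rw [hsucc, hpred, elemSymm_ratFuncX_pow, elemSymm_ratFuncX_pow, elemSymm_ratFuncX_pow,
      qNarayana, ← two_mul_choose_two, hT', hT]
    -- The quotient formula for `[M choose k+1]` needs `k + 1 ≤ M`, so `k = M` is a case of its own.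
    rcases lt_trichotomy (j + 1) M with h | h | h
    · obtain ⟨s, rfl⟩ := Nat.exists_eq_add_of_lt h
      have e0 := qBinomial_add (j + 1) (s + 1)
      have e1 := qBinomial_add (j + 2) s
      have e2 := qBinomial_add j (s + 2)
      have e3 := qBinomial_add (j + 1) (s + 2)
      have e4 := qBinomial_add (j + 2) (s + 1)
      have e5 := qInt_succ_mul_qInt_succ (j + 1) (s + 1)
      rw [show j + 1 + (s + 1) = j + 1 + s + 1 by ring] at e0 e5
      rw [show j + 2 + s = j + 1 + s + 1 by ring] at e1
      rw [show j + (s + 2) = j + 1 + s + 1 by ring] at e2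
      rw [show j + 1 + (s + 2) = j + 1 + s + 1 + 1 by ring, qFactorial_succ] at e3
      rw [show j + 2 + (s + 1) = j + 1 + s + 1 + 1 by ring, qFactorial_succ] at e4
      rw [e0, e1, e2, e3, e4, qFactorial_succ (s + 1), qFactorial_succ s,
        qFactorial_succ (j + 1), qFactorial_succ j]
      have h1 := qFactorial_ne_zero j
      have h2 := qFactorial_ne_zero s
      have h3 := qInt_succ_ne_zero j
      have h4 := qInt_succ_ne_zero s
      have h5 := qInt_succ_ne_zero (j + 1)
      have h6 := qInt_succ_ne_zero (s + 1)
      field_simp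
      linear_combination (-RatFunc.X ^ (2 * ((j + 1).choose 2 + (j + 1)))) * e5
    · subst h
      have e3 := qBinomial_add (j + 1) 1
      rw [qFactorial_succ (j + 1), qFactorial_one, mul_one, mul_div_cancel_left₀ _ hN] at e3
      rw [e3, qBinomial_self, qBinomial_self, qBinomial_of_lt (Nat.lt_succ_self (j + 1))]
      field_simp
      ring
    · rw [qBinomial_of_lt h, qBinomial_of_lt (h.trans (Nat.lt_succ_self _)),
        qBinomial_of_lt (Nat.succ_lt_succ h)]
      ring

/-! ### The `q`-Narayana numbers as specialized Schur functions -/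

theorem algebraMap_schurEval_twoColumn (M k : ℕ) :
    algebraMap (Polynomial ℝ) (RatFunc ℝ)
      (schurEval (twoColumn k)
        (fun i : Fin M => (Polynomial.X : Polynomial ℝ) ^ ((i : ℕ) + 1))) =
      qNarayana (M + 1) k := by
  rw [schurEval_twoColumn (fun i => (Polynomial.X : Polynomial ℝ) ^ (i + 1)) M k, map_sub, map_mul,
    map_pow, map_elemSymm, map_elemSymm, map_elemSymm, qNarayana_succ_eq]
  simp only [map_pow, RatFunc.algebraMap_X]

theorem stronglyQLogConcave_schurEval_twoColumn (M : ℕ) :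
    StronglyQLogConcave fun k => schurEval (twoColumn k)
      (fun i : Fin M => (Polynomial.X : Polynomial ℝ) ^ ((i : ℕ) + 1)) := by
  intro k l hl hlk i
  rw [schurEval_twoColumn_mul_sub (fun i => (Polynomial.X : Polynomial ℝ) ^ (i + 1)) M hl hlk,
    Polynomial.finsetSum_coeff]
  exact Finset.sum_nonneg fun a _ => coeff_schurEval_X_pow_nonneg _ M i

theorem mainTheorem4 :
    (∀ n : ℕ, 0 < n →
      ∃ N : ℕ → Polynomial ℝ,
        (∀ k : ℕ, algebraMap (Polynomial ℝ) (RatFunc ℝ) (N k) = qNarayana n k) ∧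
        (∀ k : ℕ, N k = schurEval (twoColumn k)
          (fun i : Fin (n - 1) => (Polynomial.X : Polynomial ℝ) ^ ((i : ℕ) + 1))) ∧
        StronglyQLogConcave N) ∧
    (∀ k l : ℕ, 1 ≤ l → l ≤ k →
      SchurPositive (schurFunction (twoColumn k) * schurFunction (twoColumn l) -
        schurFunction (twoColumn (k + 1)) * schurFunction (twoColumn (l - 1)))) := by
  refine ⟨fun n hn => ⟨_, fun k => ?_, fun k => rfl,
    stronglyQLogConcave_schurEval_twoColumn (n - 1)⟩, fun k l hl hlk => ?_⟩
  · rw [algebraMap_schurEval_twoColumn, Nat.sub_add_cancel hn]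
  · rw [schurFunction_twoColumn_mul_sub hl hlk]
    exact schurPositive_sum _ _
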